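/- **Setting.** A POMDP $\mathcal P=(S,A,P,s_0,Z,O)$ has finite sets $S,A,Z$ of states, actions and observations, a partial transition function $P:S\times A\rightharpoonup\mathsf{Dist}(S)$ ($a$ is *enabled* in $s$ if $P(s,a)$ is defined), an initial state $s_0$ and an observation map $O:S\to Z$. A history $z_0a_0z_1\dots a_{i-1}z_i$ is *valid* if it is the history of a finite prefix of an infinite path $s_0a_0s_1a_1\dots$. A policy $\sigma$ maps valid histories to actions and selects only enabled actions along its runs. A finite-state controller (FSC) $\mathcal F=(N,\gamma,\delta,n_0)$ has a finite set $N$ of nodes, $\gamma:N\times Z\to A$, $\delta:N\times Z\to N$ and $n_0\in N$; it reads the observations one by one, and in node $n$ on observation $z$ it plays $\gamma(n,z)$ and moves to $\delta(n,z)$. A policy is *regular* if it is given by an FSC on all valid histories. $\mathcal P\times\mathcal F$ is the induced Markov chain on $S\times N$ started in $(s_0,n_0)$. Let $\mathsf{Bad}\subseteq Z$ and $\alpha\in[0,1)$. $\Box\neg\mathsf{Bad}$ is the event that no observation in $\mathsf{Bad}$ ever occurs; a run of $\mathcal P\times\mathcal F$ that reaches a state in which the selected action is not enabled is blocked there and counts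 as unsafe. The reward POMDP $\mathcal P^r$ arises from $\mathcal P$ by adding an absorbing state $q$ with a fresh observation, redirecting all transitions out of states with observation in $\mathsf{Bad}$ to $q$, and giving reward $-1$ in states with observation in $\mathsf{Bad}$ and $0$ elsewhere; $\mathsf{Rew}^\lambda=\sum_i\lambda^i r_i$ is the discounted reward, and a policy of $\mathcal P$ is also used as a policy of $\mathcal P^r$ (its choices after $q$ is reached do not matter). **The procedure CPLUS** has an action oracle and a model-checking oracle. The action oracle is a fixed function from valid histories to actions; queries on invalid histories are answered by "don't care". CPLUS maintains a finite set $\mathsf S$ of rows and a finite set $\mathsf E$ of columns, both sets of sequences of observations, initially $\mathsf S=\{\varepsilon\}$ and $\mathsf E=Z$. The entry $\mathsf T(s,e)$ is the sequence of the last $|e|$ answers of the action oracle while the sequence $se$ of observations is read (each answer being the action played in the history), and $row(s)=(\mathsf T(s,e))_{e\in\mathsf E}$. CPLUS repeats the following. 1. While there are $s\in\mathsf S$, $z\in Z$ such that $row(sz)\ne row(s')$ for all $s'\in\mathsf S$, add such an $sz$ to $\mathsf S$. 2. Build a hypothesis FSC $\mathcal H$ with nodes $\{row(s):s\in\mathsf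 S\}$, initial node $row(\varepsilon)$, $\delta(row(s),z)=row(sz)$, and $\gamma(row(s),z)=\mathsf T(s,z)$, where "don't care" entries are completed by arbitrary actions. 3. If $\Pr_{\mathcal P\times\mathcal H}(\Box\neg\mathsf{Bad})>\alpha$, the model-checking oracle says yes and CPLUS terminates and returns $\mathcal H$. Otherwise the model-checking oracle returns a set $\mathcal R$ of finite unsafe paths of $\mathcal P\times\mathcal H$ whose cylinders have total probability at least $1-\alpha$; $\mathcal R$ is finite whenever a finite such set exists. 4. If for no path in $\mathcal R$ there is a valid prefix after which $\mathcal H$ and the action oracle select different actions, CPLUS terminates with "fail". Otherwise it takes a path in $\mathcal R$ that has such a prefix, takes the sequence $w$ of observations of the shortest such prefix, and adds to $\mathsf E$ a Rivest–Schapire suffix of $w$: a nonempty $e$ with $w=uze$, $z\in Z$, and $\mathsf T(sz,e)\neq\mathsf T(s',e)$, where $s,s'\in\mathsf S$ are the rows whose nodes $\mathcal H$ reaches on $u$ and on $uz$. **Theorem.** Let $\mathcal P$, $\mathsf{Bad}$, $\alpha$ be as above. * (Correctness) For every action oracle: if some run of CPLUS terminates and returns an FSC $\mathcal H$, then $\Pr_{\mathcal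 P\times\mathcal H}(\Box\neg\mathsf{Bad})>\alpha$. * (Relative completeness) For every $\varepsilon>0$ and every regular policy $\sigma$ of $\mathcal P$ there is $\lambda_0\in(0,1)$ such that for every $\lambda\in(\lambda_0,1)$: if $1+\mathbb E^{\sigma}_{\mathcal P^r}(\mathsf{Rew}^\lambda)>\alpha+\varepsilon$ and the action oracle follows $\sigma$, then CPLUS terminates and returns an FSC. That is, whatever the remaining choices (row added, completion of "don't care" entries, answers of the model-checking oracle, selected path and suffix), there is no infinite run, and every run ends by returning an FSC. -/

import Mathlib

open MeasureTheory ProbabilityTheory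

namespace CPlus

/-! ### Markov chains and the probability measure on their infinite runs -/

/-- A (discrete-time, homogeneous) Markov chain with one initial state. -/
structure MarkovChain (X : Type*) where
  /-- transition function -/
  step : X → PMF X
  /-- initial state -/
  init : X

/-- The σ-algebra on infinite sequences of states generated by the cylinder sets. -/
abbrev runSpace (X : Type*) : MeasurableSpace (ℕ → X) :=
  @MeasurableSpace.pi ℕ (fun _ => X) (fun _ => ⊤)

namespace MarkovChain

variable {X : Type*} [Countable X]

/-- The one-step kernel at time `n`: it looks only at the current state. -/
noncomputable def kernel (M : MarkovChain X) (n : ℕ) :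
    @Kernel ((i : Finset.Iic n) → X) X (@MeasurableSpace.pi _ (fun _ => X) (fun _ => ⊤)) ⊤ :=
  letI : MeasurableSpace X := ⊤
  Kernel.ofFunOfCountable fun x : (i : Finset.Iic n) → X =>
    (M.step (x ⟨n, Finset.mem_Iic.2 le_rfl⟩)).toMeasure

theorem isMarkovKernel_kernel (M : MarkovChain X) (n : ℕ) :
    @IsMarkovKernel _ _ (@MeasurableSpace.pi _ (fun _ => X) (fun _ => ⊤)) ⊤ (M.kernel n) := by
  let : MeasurableSpace X := ⊤
  refine ⟨fun x => ?_⟩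
  change IsProbabilityMeasure (M.step (x ⟨n, Finset.mem_Iic.2 le_rfl⟩)).toMeasure
  infer_instance

/-- The probability measure on infinite runs induced by the chain (Ionescu-Tulcea). -/
noncomputable def runMeasure (M : MarkovChain X) : @Measure (ℕ → X) (runSpace X) :=
  letI : MeasurableSpace X := ⊤
  haveI := M.isMarkovKernel_kernel
  Kernel.traj (X := fun _ => X) M.kernel 0 (fun _ => M.init)

/-- Probability of an event. -/
noncomputable def Pr (M : MarkovChain X) (E : Set (ℕ → X)) : ℝ :=
  (M.runMeasure E).toReal

/-- Expectation of a random variable. -/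
noncomputable def expect (M : MarkovChain X) (f : ℕ → X → ℝ) : ℝ :=
  @integral (ℕ → X) ℝ _ _ (runSpace X) M.runMeasure (fun ω => ∑' i, f i (ω i))

end MarkovChain

/-- Infinite sequences that have some element of `R` as a prefix. -/
def Cyl {X : Type*} (R : Set (List X)) : Set (ℕ → X) :=
  {ω | ∃ ρ ∈ R, (List.range ρ.length).map ω = ρ}

/-! ### POMDPs, histories, policies, finite-state controllers -/

/-- A partially observable Markov decision process. `trans s a = none` means that the action `a` is
not enabled in the state `s`. -/
structure POMDP (S A Z : Type*) where
  trans : S → A → Option (PMF S)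
  init : S
  obs : S → Z

/-- A history `z₀ a₀ z₁ a₁ … a_{i-1} z_i`, stored as `([(z₀, a₀), …, (z_{i-1}, a_{i-1})], z_i)`. -/
abbrev History (Z A : Type*) := List (Z × A) × Z

/-- `h · a · z` -/
def History.snoc {Z A : Type*} (h : History Z A) (a : A) (z : Z) : History Z A :=
  (h.1 ++ [(h.2, a)], z)

/-- A finite-state controller with set of nodes `N`. -/
structure FSC (Z A N : Type*) where
  act : N → Z → A
  next : N → Z → N
  start : N

namespace FSC

variable {Z A N : Type*}

/-- The node reached after reading a sequence of observations. -/
def run (F : FSC Z A N) (w : List Z) : N := w.foldl F.next F.start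

/-- The policy of the controller. -/
def policy (F : FSC Z A N) (h : History Z A) : A := F.act (F.run (h.1.map Prod.fst)) h.2

end FSC

namespace POMDP

variable {S A Z : Type*}

/-- Infinite paths `s₀ a₀ s₁ a₁ …` from the initial state. -/
def IsPath (P : POMDP S A Z) (s : ℕ → S) (a : ℕ → A) : Prop :=
  s 0 = P.init ∧ ∀ t, ∃ μ, P.trans (s t) (a t) = some μ ∧ s (t + 1) ∈ μ.support

/-- Valid histories: the histories of the finite prefixes of infinite paths. -/
def Valid (P : POMDP S A Z) (h : History Z A) : Prop :=
  ∃ s a, P.IsPath s a ∧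
    ∃ i : ℕ, h = ((List.range i).map (fun j => (P.obs (s j), a j)), P.obs (s i))

/-- `(s, h)` is reachable in the chain induced by `σ`. -/
inductive Reach (P : POMDP S A Z) (σ : History Z A → A) : S → History Z A → Prop
  | init : Reach P σ P.init ([], P.obs P.init)
  | step {s : S} {h : History Z A} {μ : PMF S} {s' : S} :
      Reach P σ s h → P.trans s (σ h) = some μ → s' ∈ μ.support →
        Reach P σ s' (h.snoc (σ h) (P.obs s'))

/-- `σ` is a policy of `P`: along its own runs it only selects enabled actions, so that it induces
a Markov chain. Its values on sequences that are not valid histories play no role. -/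
def IsPolicy (P : POMDP S A Z) (σ : History Z A → A) : Prop :=
  ∀ s h, P.Reach σ s h → ∃ μ, P.trans s (σ h) = some μ

/-- `σ` is regular: on all valid histories it is given by a finite-state controller. -/
def IsRegular (P : POMDP S A Z) (σ : History Z A → A) : Prop :=
  ∃ (N : Type) (_ : Finite N) (F : FSC Z A N), ∀ h, P.Valid h → σ h = F.policy h

/-- The Markov chain induced by `σ`: its states are pairs of a state and a history.
(If the selected action is not enabled, the run is blocked and stays where it is.) -/
noncomputable def inducedChain (P : POMDP S A Z) (σ : History Z A → A) :
    MarkovChain (S × History Z A) where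
  step x := match P.trans x.1 (σ x.2) with
    | some μ => μ.map fun s' => (s', x.2.snoc (σ x.2) (P.obs s'))
    | none => PMF.pure x
  init := (P.init, ([], P.obs P.init))

/-- Expected discounted reward of `σ` for the reward function `r` and the discount factor `lam`. -/
noncomputable def expReward [Finite S] [Finite A] [Finite Z] (P : POMDP S A Z) (r : Z → A → ℚ)
    (σ : History Z A → A) (lam : ℝ) : ℝ :=
  (P.inducedChain σ).expect fun i x => lam ^ i * (r (P.obs x.1) (σ x.2) : ℝ)

open Classical in
/-- The POMDP `Pʳ`: a fresh absorbing state `none` with a fresh observation `none` is added, and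
all transitions that leave unsafe states are redirected to it. -/
noncomputable def rewardPOMDP (P : POMDP S A Z) (Bad : Set Z) :
    POMDP (Option S) A (Option Z) where
  trans q a := match q with
    | none => some (PMF.pure none)
    | some s => if P.obs s ∈ Bad then some (PMF.pure none) else (P.trans s a).map (PMF.map some)
  init := some P.init
  obs := Option.map P.obs

open Classical in
/-- The reward function of `Pʳ`: `-1` on unsafe observations and `0` elsewhere. -/
noncomputable def badReward (Bad : Set Z) : Option Z → A → ℚ :=
  fun o _ => if ∃ z ∈ Bad, o = some z then -1 else 0

/-- A policy of `P` read as a policy of `Pʳ`. On histories over `Z` it is `σ`; once the fresh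
observation has occurred the choice of the action is irrelevant. -/
def liftPolicy (P : POMDP S A Z) (σ : History Z A → A) : History (Option Z) A → A :=
  fun h => σ (h.1.filterMap (fun p => p.1.map fun z => (z, p.2)), h.2.getD (P.obs P.init))

/-- `E^σ_{Pʳ}(Rew^lam)` -/
noncomputable def safetyReward [Finite S] [Finite A] [Finite Z] (P : POMDP S A Z) (Bad : Set Z)
    (σ : History Z A → A) (lam : ℝ) : ℝ :=
  (P.rewardPOMDP Bad).expReward (badReward Bad) (P.liftPolicy σ) lam

/-! ### The product of a POMDP and a controller; counterexamples -/

section Product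

variable {N : Type*}

/-- The action that `F` selects in a state of `P × F`. -/
def actionAt (P : POMDP S A Z) (F : FSC Z A N) (x : S × N) : A := F.act x.2 (P.obs x.1)

/-- The Markov chain `P × F`. (If the selected action is not enabled, the run is blocked and stays
where it is.) -/
noncomputable def prod (P : POMDP S A Z) (F : FSC Z A N) : MarkovChain (S × N) where
  step x := match P.trans x.1 (P.actionAt F x) with
    | some μ => μ.map fun s' => (s', F.next x.2 (P.obs x.1))
    | none => PMF.pure x
  init := (P.init, F.start)

/-- Unsafe states of `P × F`: the observation is bad, or the run is blocked there because the
selected action is not enabled. The second case never occurs if all actions are enabled. -/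
def UnsafeState (P : POMDP S A Z) (Bad : Set Z) (F : FSC Z A N) (x : S × N) : Prop :=
  P.obs x.1 ∈ Bad ∨ P.trans x.1 (P.actionAt F x) = none

/-- The event `□ ¬Bad` in `P × F`. -/
def alwaysSafe (P : POMDP S A Z) (Bad : Set Z) (F : FSC Z A N) : Set (ℕ → S × N) :=
  {ω | ∀ i, ¬ P.UnsafeState Bad F (ω i)}

/-- `Pr_{P × F}(□ ¬Bad)` -/
noncomputable def prSafe [Finite S] [Finite N] (P : POMDP S A Z) (Bad : Set Z) (F : FSC Z A N) :
    ℝ :=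
  (P.prod F).Pr (P.alwaysSafe Bad F)

/-- Transitions of `P × F`. -/
def Edge (P : POMDP S A Z) (F : FSC Z A N) (x y : S × N) : Prop :=
  ∃ μ, P.trans x.1 (P.actionAt F x) = some μ ∧ y.1 ∈ μ.support ∧ y.2 = F.next x.2 (P.obs x.1)

/-- Finite paths of `P × F` from the initial state. -/
def IsFinPath (P : POMDP S A Z) (F : FSC Z A N) (ρ : List (S × N)) : Prop :=
  ρ.head? = some (P.init, F.start) ∧ ρ.IsChain (P.Edge F)

/-- Counterexamples: sets of finite unsafe paths with cumulative probability at least `1 - α`. -/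
def IsCounterexample [Finite S] [Finite N] (P : POMDP S A Z) (Bad : Set Z) (α : ℝ)
    (F : FSC Z A N) (R : Set (List (S × N))) : Prop :=
  (∀ ρ ∈ R, P.IsFinPath F ρ ∧ ∃ x ∈ ρ, P.UnsafeState Bad F x) ∧ 1 - α ≤ (P.prod F).Pr (Cyl R)

/-- Admissible negative answers of the model-checking oracle: a counterexample, which is finite
whenever there is a finite one. (There can only fail to be a finite one for a controller with
`Pr(□ ¬Bad) = α` exactly.) -/
def IsAnswer [Finite S] [Finite N] (P : POMDP S A Z) (Bad : Set Z) (α : ℝ)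
    (F : FSC Z A N) (R : Set (List (S × N))) : Prop :=
  P.IsCounterexample Bad α F R ∧
    (R.Finite ∨ ∀ R', P.IsCounterexample Bad α F R' → ¬ R'.Finite)

/-- The history of the prefix of `ρ` that ends in the state `x` at position `i`. -/
def pathHistory (P : POMDP S A Z) (F : FSC Z A N) (ρ : List (S × N)) (i : ℕ) (x : S × N) :
    History Z A :=
  ((ρ.take i).map (fun y => (P.obs y.1, P.actionAt F y)), P.obs x.1)

/-- After the prefix of `ρ` that ends at position `i`, the oracle and `F` select different
actions. -/
def DisagreeAt (P : POMDP S A Z) (oracle : History Z A → A) (F : FSC Z A N) (ρ : List (S × N))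
    (i : ℕ) : Prop :=
  ∃ x, ρ[i]? = some x ∧ P.Valid (P.pathHistory F ρ i x) ∧
    oracle (P.pathHistory F ρ i x) ≠ P.actionAt F x

/-- Position `i` ends the shortest prefix of `ρ` after which the oracle and `F` select different
actions. -/
def FirstDisagreement (P : POMDP S A Z) (oracle : History Z A → A) (F : FSC Z A N)
    (ρ : List (S × N)) (i : ℕ) : Prop :=
  P.DisagreeAt oracle F ρ i ∧ ∀ j < i, ¬ P.DisagreeAt oracle F ρ j

end Product

/-! ### Observation tables -/

open Classical in
/-- Answers to action queries while a sequence of observations is read. The first argument is the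
history so far (without a last observation), or `none` if it is not valid any more; the answer
`none` is the symbol "don't care" for sequences that are not valid histories. -/
noncomputable def answers (P : POMDP S A Z) (oracle : History Z A → A) :
    Option (List (Z × A)) → List Z → List (Option A)
  | _, [] => []
  | none, _ :: w => none :: answers P oracle none w
  | some l, z :: w =>
      if P.Valid (l, z) then
        some (oracle (l, z)) :: answers P oracle (some (l ++ [(z, oracle (l, z))])) w
      else none :: answers P oracle none w

/-- The entry of the table in row `s` and column `e`. -/
noncomputable def entry (P : POMDP S A Z) (oracle : History Z A → A) (s e : List Z) :
    List (Option A) :=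
  (P.answers oracle (some []) (s ++ e)).drop s.length

end POMDP

/-- The index sets of an observation table: the upper rows and the columns. The entries are given
by `POMDP.entry`. -/
structure Table (Z : Type*) where
  rows : Finset (List Z)
  cols : Finset (List Z)

namespace Table

variable {S A Z : Type*}

/-- The initial table: the row of the empty sequence, and a column for each observation. -/
def initial (Z : Type*) [Fintype Z] [DecidableEq Z] : Table Z where
  rows := {[]}
  cols := Finset.univ.image fun z => [z]

def addRow [DecidableEq Z] (T : Table Z) (s : List Z) : Table Z := ⟨insert s T.rows, T.cols⟩

def addCol [DecidableEq Z] (T : Table Z) (e : List Z) : Table Z := ⟨T.rows, insert e T.cols⟩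

/-- `row(s)` -/
noncomputable def row (P : POMDP S A Z) (oracle : History Z A → A) (T : Table Z) (s : List Z) :
    {e // e ∈ T.cols} → List (Option A) :=
  fun e => P.entry oracle s e.1

/-- For all `s'` in `rows · Z` there is `s` in `rows` with `row(s) = row(s')`. -/
def Closed (P : POMDP S A Z) (oracle : History Z A → A) (T : Table Z) : Prop :=
  ∀ s ∈ T.rows, ∀ z, ∃ s' ∈ T.rows, T.row P oracle s' = T.row P oracle (s ++ [z])

/-- The nodes of the hypothesis: the values `row(s)` for `s` in `rows`. -/
abbrev Node (P : POMDP S A Z) (oracle : History Z A → A) (T : Table Z) :=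
  ↥((T.row P oracle) '' (T.rows : Set (List Z)))

/-- `F` is a hypothesis of the (closed) table. Entries that are "don't care" leave the action of
the hypothesis free. -/
structure IsHypothesis (P : POMDP S A Z) (oracle : History Z A → A) (T : Table Z)
    (F : FSC Z A (T.Node P oracle)) : Prop where
  start_eq : F.start.1 = T.row P oracle []
  next_eq : ∀ s (hs : s ∈ T.rows) (z : Z),
    (F.next ⟨T.row P oracle s, Set.mem_image_of_mem _ hs⟩ z).1 = T.row P oracle (s ++ [z])
  act_eq : ∀ s (hs : s ∈ T.rows) (z : Z) (a : A), P.entry oracle s [z] = [some a] →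
    F.act ⟨T.row P oracle s, Set.mem_image_of_mem _ hs⟩ z = a

/-- Rivest-Schapire processing of a sequence of observations `w` on which the hypothesis errs:
`e` is a nonempty suffix of `w` at a breakpoint. That is, `w = u z e`, and if `s` and `s'` are the
rows of the table whose nodes are reached by `u` and by `u z`, then the column `e`
distinguishes `s z` from `s'`. -/
def IsBreakpoint (P : POMDP S A Z) (oracle : History Z A → A) (T : Table Z)
    (F : FSC Z A (T.Node P oracle)) (w e : List Z) : Prop :=
  e ≠ [] ∧ ∃ u z, w = u ++ z :: e ∧ ∃ s ∈ T.rows, ∃ s' ∈ T.rows,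
    T.row P oracle s = (F.run u).1 ∧ T.row P oracle s' = (F.run (u ++ [z])).1 ∧
    P.entry oracle (s ++ [z]) e ≠ P.entry oracle s' e

end Table

/-! ### The procedure -/

/-- Configurations of the procedure. -/
inductive Config {S A Z : Type*} (P : POMDP S A Z) (oracle : History Z A → A)
  /-- the current observation table -/
  | table (T : Table Z)
  /-- terminated, and returned the controller `F` -/
  | returned (T : Table Z) (F : FSC Z A (T.Node P oracle))
  /-- terminated with the answer "fail" -/
  | fail

/-- One step of the procedure with the given action oracle. The remaining choices (which row is
added, the completion of "don't care" entries, the answer of the model-checking oracle, the path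
and the suffix selected from it) are left open. -/
inductive Step {S A Z : Type*} [Finite S] [DecidableEq Z] (P : POMDP S A Z) (Bad : Set Z) (α : ℝ)
    (oracle : History Z A → A) : Config P oracle → Config P oracle → Prop
  /-- The table is not closed: a row is added. -/
  | close (T : Table Z) (s : List Z) (z : Z) (hs : s ∈ T.rows)
      (hnew : ∀ s' ∈ T.rows, T.row P oracle s' ≠ T.row P oracle (s ++ [z])) :
      Step P Bad α oracle (.table T) (.table (T.addRow (s ++ [z])))
  /-- The table is closed and the model-checking oracle answers "yes" for the hypothesis. -/
  | accept (T : Table Z) (F : FSC Z A (T.Node P oracle)) (hT : T.Closed P oracle)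
      (hF : T.IsHypothesis P oracle F) (hsafe : α < P.prSafe Bad F) :
      Step P Bad α oracle (.table T) (.returned T F)
  /-- The table is closed and the model-checking oracle returns the counterexample `R` for the
  hypothesis. For some path in `R` with a prefix on which oracle and hypothesis disagree, a
  Rivest-Schapire suffix of the sequence of observations of the prefix becomes a column. -/
  | refine (T : Table Z) (F : FSC Z A (T.Node P oracle)) (hT : T.Closed P oracle)
      (hF : T.IsHypothesis P oracle F) (hviol : P.prSafe Bad F ≤ α)
      (R : Set (List (S × T.Node P oracle))) (hR : P.IsAnswer Bad α F R)
      (ρ : List (S × T.Node P oracle)) (hρ : ρ ∈ R) (i : ℕ)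
      (hi : P.FirstDisagreement oracle F ρ i) (e : List Z)
      (he : T.IsBreakpoint P oracle F ((ρ.take (i + 1)).map fun x => P.obs x.1) e) :
      Step P Bad α oracle (.table T) (.table (T.addCol e))
  /-- The table is closed and the model-checking oracle returns a counterexample for the
  hypothesis, but on its paths oracle and hypothesis never disagree. -/
  | fail (T : Table Z) (F : FSC Z A (T.Node P oracle)) (hT : T.Closed P oracle)
      (hF : T.IsHypothesis P oracle F) (hviol : P.prSafe Bad F ≤ α)
      (R : Set (List (S × T.Node P oracle))) (hR : P.IsAnswer Bad α F R)
      (hno : ∀ ρ ∈ R, ∀ i, ¬ P.DisagreeAt oracle F ρ i) :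
      Step P Bad α oracle (.table T) .fail

section Runs

variable {S A Z : Type*} [Finite S] [Fintype Z] [DecidableEq Z]

/-- Configurations that occur in some run. -/
def Reachable (P : POMDP S A Z) (Bad : Set Z) (α : ℝ) (oracle : History Z A → A)
    (c : Config P oracle) : Prop :=
  Relation.ReflTransGen (Step P Bad α oracle) (.table (Table.initial Z)) c

/-- Some run of the procedure terminates and returns the controller `F`. -/
def Returns (P : POMDP S A Z) (Bad : Set Z) (α : ℝ) (oracle : History Z A → A)
    {T : Table Z} (F : FSC Z A (T.Node P oracle)) : Prop :=
  Reachable P Bad α oracle (.returned T F)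

/-- Every run of the procedure terminates and returns a controller: there is no infinite run, and
a run can end only by returning a controller. -/
def AlwaysReturns (P : POMDP S A Z) (Bad : Set Z) (α : ℝ) (oracle : History Z A → A) : Prop :=
  (¬ ∃ c : ℕ → Config P oracle,
      c 0 = .table (Table.initial Z) ∧ ∀ n, Step P Bad α oracle (c n) (c (n + 1))) ∧
  ∀ c, Reachable P Bad α oracle c → (∀ c', ¬ Step P Bad α oracle c c') →
    ∃ (T : Table Z) (F : FSC Z A (T.Node P oracle)), c = .returned T F

end Runs

end CPlus

open CPlus

/-!
Correctness is immediate: a controller is returned only after the model checker has confirmed the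
bound. Relative completeness combines three facts about an action oracle that follows a regular
policy `σ`.

*Termination.* Whether a history is valid depends only on its last observation and on the belief,
that is, the set of states compatible with it before that observation; the answer of `σ` depends
only on a node of its controller. So the rows fall into finitely many classes
(`POMDP.IsRegular.exists_finite_classes`). A new row has a value that no row had before, and a
Rivest-Schapire column separates two classes that no column separated before; hence the number of
separated pairs of classes plus the number of rows grows strictly in each step and is bounded
(`Step.potential_lt`, `Table.IsReduced.potential_le`).

*No table is stuck.* In a closed table with pairwise different rows there is a hypothesis, and the
set of all unsafe finite paths is a counterexample whenever the hypothesis is not safe enough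
(`POMDP.le_pr_cyl_unsafePaths`). If hypothesis and oracle disagree on a path, then following the last
answer of the oracle through the representative rows along the path, one finds a position at which
the answer changes, and this is a breakpoint (`Table.exists_isBreakpoint`).

*No failure.* Suppose that oracle and hypothesis never disagree on the paths of a counterexample.
Then these paths are runs of `σ`. As `σ` is a policy they are not blocked, so they reach a bad
observation, and cut off there they are paths of `Pʳ` under `σ` with the same probabilities. Hence
`∑ i, pᵢ ≥ 1 - α`, where `pᵢ` is the probability that `Pʳ` is in a bad state at time `i`
(`POMDP.runMeasure_cyl_le`). The expected reward is `-∑ i, λ ^ i * pᵢ`, and since the `pᵢ` do not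
depend on `λ` or on the hypothesis, it is at most `-(1 - α) + ε` for all `λ` close to `1`
(`exists_discount_le`), which the assumption on the reward excludes
(`POMDP.exists_discount_safetyReward`).
-/

namespace CPlus

open Filter Topology
open scoped ENNReal

/-! ### Cylinder probabilities -/

namespace MarkovChain

variable {X : Type*} [Countable X]

theorem runMeasure_univ (M : MarkovChain X) : M.runMeasure Set.univ = 1 := by
  let : MeasurableSpace X := ⊤
  have := M.isMarkovKernel_kernel
  exact measure_univ (μ := Kernel.traj (X := fun _ => X) M.kernel 0 (fun _ => M.init))

theorem measurableSet_run_eq (n : ℕ) (x : X) :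
    @MeasurableSet (ℕ → X) (runSpace X) {ω | ω n = x} := by
  let : MeasurableSpace X := ⊤
  exact measurable_pi_apply (X := fun _ => X) n (measurableSet_singleton x)

theorem measurableSet_cylinder (n : ℕ) (f : ℕ → X) :
    @MeasurableSet (ℕ → X) (runSpace X) {ω | ∀ j ≤ n, ω j = f j} := by
  let : MeasurableSpace X := ⊤
  rw [show {ω : ℕ → X | ∀ j ≤ n, ω j = f j} = ⋂ j, ⋂ _ : j ≤ n, {ω | ω j = f j} by
    ext; simp]
  exact MeasurableSet.iInter fun j => MeasurableSet.iInter fun _ => measurableSet_run_eq j (f j)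

theorem runMeasure_cylinder_zero (M : MarkovChain X) (f : ℕ → X) (hf : f 0 = M.init) :
    M.runMeasure {ω | ∀ j ≤ 0, ω j = f j} = 1 := by
  let : MeasurableSpace X := ⊤
  have := M.isMarkovKernel_kernel
  have h := Kernel.traj_map_frestrictLe_apply (X := fun _ => X) (κ := M.kernel) 0 0
    (fun _ => M.init)
  rw [Kernel.partialTraj_self, Kernel.id_apply] at h
  have hs : MeasurableSet {(fun _ => M.init : (i : Finset.Iic 0) → X)} :=
    measurableSet_singleton _
  have h2 := DFunLike.congr_fun h {(fun _ => M.init : (i : Finset.Iic 0) → X)}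
  rw [Measure.map_apply (Preorder.measurable_frestrictLe 0) hs, Measure.dirac_apply' _ hs] at h2
  rw [Set.indicator_of_mem (by simp)] at h2
  rw [runMeasure]
  refine Eq.trans (congrArg _ ?_) h2
  ext ω
  simp [funext_iff, hf]

theorem runMeasure_cylinder_succ (M : MarkovChain X) (n : ℕ) (f : ℕ → X) :
    M.runMeasure {ω | ∀ j ≤ n + 1, ω j = f j} =
      M.runMeasure {ω | ∀ j ≤ n, ω j = f j} * M.step (f n) (f (n + 1)) := by
  let : MeasurableSpace X := ⊤
  have := M.isMarkovKernel_kernel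
  have h := Kernel.partialTraj_compProd_eq_map_traj (X := fun _ => X) (κ := M.kernel)
    (Nat.zero_le n) (x₀ := fun _ => M.init)
  rw [← Kernel.traj_map_frestrictLe_apply] at h
  set v : (i : Finset.Iic n) → X := fun i => f i with hv
  have h2 := DFunLike.congr_fun h ({v} ×ˢ {f (n + 1)})
  rw [Measure.compProd_apply_prod (measurableSet_singleton _) (measurableSet_singleton _),
    lintegral_singleton, Measure.map_apply (Preorder.measurable_frestrictLe n)
      (measurableSet_singleton _),
    Measure.map_apply (by fun_prop)
      ((measurableSet_singleton _).prod (measurableSet_singleton _))] at h2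
  have h3 : M.kernel n v {f (n + 1)} = M.step (f n) (f (n + 1)) := by
    change (M.step (v ⟨n, _⟩)).toMeasure {f (n + 1)} = _
    rw [PMF.toMeasure_apply_singleton _ _ (measurableSet_singleton _)]
  rw [h3, mul_comm] at h2
  rw [runMeasure]
  refine Eq.trans (congrArg _ ?_) (h2.symm.trans ?_)
  · ext ω
    simp only [Set.mem_ofPred_eq, Set.mem_preimage, Set.mem_prod, Set.mem_singleton_iff,
      funext_iff, hv, Subtype.forall, Finset.mem_Iic, Preorder.frestrictLe_apply]
    constructor
    · exact fun h => ⟨fun j hj => h j (by omega), h _ le_rfl⟩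
    · rintro ⟨h1, h2⟩ j hj
      rcases Nat.lt_or_ge n j with h | h
      · obtain rfl : j = n + 1 := by omega
        exact h2
      · exact h1 j h
  · congr 2
    ext ω
    simp [funext_iff, hv]

end MarkovChain

/-! ### Comparing Markov chains path by path; discounted expectations -/

namespace MarkovChain

/-- Each set of runs is covered by countably many cylinders of length `n + 1` around members of the
set, one for each possible prefix. -/
theorem exists_cylinder_cover {X : Type*} [Countable X] (n : ℕ) (A : Set (ℕ → X)) :
    ∃ B ⊆ A, B.Countable ∧ A ⊆ ⋃ f ∈ B, {ω | ∀ j ≤ n, ω j = f j} ∧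
      ∀ f ∈ B, ∀ g ∈ B, (∀ j ≤ n, f j = g j) → f = g := by
  let restr : (ℕ → X) → Fin (n + 1) → X := fun ω j => ω j
  have hr : ∀ f g, restr f = restr g ↔ ∀ j ≤ n, f j = g j := by
    intro f g
    rw [funext_iff]
    exact ⟨fun h j hj => h ⟨j, by omega⟩, fun h j => h j (by omega)⟩
  obtain ⟨B, hBA, hB⟩ := (Set.surjOn_image restr A).exists_bijOn_subset
  refine ⟨B, hBA, Set.countable_of_injective_of_countable_image hB.injOn (Set.to_countable _),
    fun ω hω => ?_, fun f hf g hg h => hB.injOn hf hg ((hr f g).2 h)⟩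
  obtain ⟨f, hf, hfω⟩ := hB.surjOn (Set.mem_image_of_mem restr hω)
  exact Set.mem_biUnion hf fun j hj => ((hr f ω).1 hfω j hj).symm

variable {X Y : Type*} [Countable X] [Countable Y]

theorem runMeasure_step_eq_zero (M : MarkovChain X) (n : ℕ) :
    M.runMeasure {ω | M.step (ω n) (ω (n + 1)) = 0} = 0 := by
  let : MeasurableSpace X := ⊤
  obtain ⟨B, hBA, hB, hcov, -⟩ :=
    exists_cylinder_cover (n + 1) {ω | M.step (ω n) (ω (n + 1)) = 0}
  refine measure_mono_null hcov ((measure_biUnion_null_iff hB).2 fun f hf => ?_)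
  rw [runMeasure_cylinder_succ, show M.step (f n) (f (n + 1)) = 0 from hBA hf, mul_zero]

theorem runMeasure_init_ne (M : MarkovChain X) : M.runMeasure {ω | ω 0 ≠ M.init} = 0 := by
  let : MeasurableSpace X := ⊤
  have h := M.runMeasure_cylinder_zero (fun _ => M.init) rfl
  have hc := measure_compl (μ := M.runMeasure) (measurableSet_cylinder 0 fun _ : ℕ => M.init)
    (by rw [h]; exact ENNReal.one_ne_top)
  rw [h, runMeasure_univ, tsub_self] at hc
  refine measure_mono_null (fun ω hω => ?_) hc
  simpa using hω

/-- Comparison of two chains along a map `Φ` of runs that, on the runs in `A`, does not decrease the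
probabilities of the first `n` transitions and is injective on prefixes. The cylinders around the
runs `Φ ω` are then disjoint and at least as probable as those around the runs `ω`. -/
theorem runMeasure_le_of_map (M : MarkovChain X) (M' : MarkovChain Y) (n : ℕ)
    (Φ : (ℕ → X) → ℕ → Y) {A : Set (ℕ → X)} {B : Set (ℕ → Y)}
    (hinit : ∀ ω ∈ A, Φ ω 0 = M'.init)
    (hstep : ∀ ω ∈ A, ∀ j < n,
      M.step (ω j) (ω (j + 1)) ≤ M'.step (Φ ω j) (Φ ω (j + 1)))
    (hinj : ∀ ω ∈ A, ∀ ω' ∈ A, (∀ j ≤ n, Φ ω j = Φ ω' j) → ∀ j ≤ n, ω j = ω' j)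
    (hB : ∀ ω ∈ A, ∀ ω', (∀ j ≤ n, ω' j = Φ ω j) → ω' ∈ B) :
    M.runMeasure A ≤ M'.runMeasure B := by
  let : MeasurableSpace X := ⊤
  let : MeasurableSpace Y := ⊤
  have hcyl : ∀ ω ∈ A, ∀ m ≤ n, M.runMeasure {ω' | ∀ j ≤ m, ω' j = ω j} ≤
      M'.runMeasure {ω' | ∀ j ≤ m, ω' j = Φ ω j} := by
    intro ω hω m
    induction m with
    -- The cylinder on the left has probability `0` if `ω` does not start in the initial state.
    | zero =>
      intro _
      rw [runMeasure_cylinder_zero M' (Φ ω) (hinit ω hω), ← M.runMeasure_univ]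
      exact measure_mono (Set.subset_univ _)
    | succ m ih =>
      intro hm
      rw [runMeasure_cylinder_succ, runMeasure_cylinder_succ]
      exact mul_le_mul' (ih (by omega)) (hstep ω hω m hm)
  obtain ⟨C, hCA, hC, hcov, hCinj⟩ := exists_cylinder_cover n A
  have : Countable C := hC.to_subtype
  calc M.runMeasure A ≤ M.runMeasure (⋃ f ∈ C, {ω | ∀ j ≤ n, ω j = f j}) := measure_mono hcov
    _ ≤ ∑' f : C, M.runMeasure {ω | ∀ j ≤ n, ω j = f.1 j} := measure_biUnion_le _ hC _
    _ ≤ ∑' f : C, M'.runMeasure {ω | ∀ j ≤ n, ω j = Φ f.1 j} :=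
      ENNReal.tsum_le_tsum fun f => hcyl f.1 (hCA f.2) n le_rfl
    _ = M'.runMeasure (⋃ f : C, {ω | ∀ j ≤ n, ω j = Φ f.1 j}) := by
      refine (measure_iUnion (fun f g hfg => ?_) fun f => measurableSet_cylinder n _).symm
      refine Set.disjoint_left.2 fun ω hf hg => hfg (Subtype.ext ?_)
      exact hCinj _ f.2 _ g.2 (hinj _ (hCA f.2) _ (hCA g.2)
        fun j hj => (hf j hj).symm.trans (hg j hj))
    _ ≤ M'.runMeasure B :=
      measure_mono (Set.iUnion_subset fun f ω hω => hB _ (hCA f.2) ω hω)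

open Classical in
/-- The expected discounted reward for the reward `-1` in `B` and `0` elsewhere, as a sum over the
times at which the run may be in `B`. Sum and integral are exchanged by absolute convergence. -/
theorem hasSum_expect_discounted (M : MarkovChain X) (B : Set X) {lam : ℝ} (h0 : 0 ≤ lam)
    (h1 : lam < 1) :
    HasSum (fun i => lam ^ i * M.Pr {ω | ω i ∈ B})
      (-M.expect fun i x => lam ^ i * if x ∈ B then -1 else 0) := by
  let : MeasurableSpace X := ⊤
  have : IsFiniteMeasure M.runMeasure := ⟨by rw [runMeasure_univ]; exact ENNReal.one_lt_top⟩
  have hmeas : ∀ i, MeasurableSet {ω : ℕ → X | ω i ∈ B} := fun i =>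
    measurable_pi_apply (X := fun _ => X) i (MeasurableSet.of_discrete (s := B))
  set F : ℕ → (ℕ → X) → ℝ := fun i ω => lam ^ i * if ω i ∈ B then -1 else 0 with hF
  have hF' : ∀ i, F i = {ω : ℕ → X | ω i ∈ B}.indicator fun _ => -lam ^ i := by
    intro i
    ext ω
    by_cases h : ω i ∈ B <;> simp [hF, h]
  have hint : ∀ i, Integrable (F i) M.runMeasure := fun i => by
    rw [hF' i]
    exact (integrable_const _).indicator (hmeas i)
  have hval : ∀ i, ∫ ω, F i ω ∂M.runMeasure = -(lam ^ i * M.Pr {ω | ω i ∈ B}) := fun i => by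
    rw [hF' i, integral_indicator_const _ (hmeas i), smul_eq_mul, Pr, Measure.real]
    ring
  have hnorm : ∀ i, ∫ ω, ‖F i ω‖ ∂M.runMeasure = lam ^ i * M.Pr {ω | ω i ∈ B} := fun i => by
    have : ∀ ω, ‖F i ω‖ = -F i ω := fun ω => by
      rw [Real.norm_of_nonpos]
      by_cases h : ω i ∈ B <;> simp [hF, h, pow_nonneg h0]
    simp only [this]
    rw [integral_neg, hval, neg_neg]
  have hsum : Summable fun i => ∫ ω, ‖F i ω‖ ∂M.runMeasure := by
    simp only [hnorm]
    refine Summable.of_nonneg_of_le (fun i => mul_nonneg (pow_nonneg h0 i) ENNReal.toReal_nonneg)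
      (fun i => mul_le_of_le_one_right (pow_nonneg h0 i) ?_) (summable_geometric_of_lt_one h0 h1)
    refine ENNReal.toReal_le_of_le_ofReal zero_le_one ?_
    rw [ENNReal.ofReal_one, ← M.runMeasure_univ]
    exact measure_mono (Set.subset_univ _)
  have h := (hasSum_integral_of_summable_integral_norm hint hsum).neg
  simp only [hval, neg_neg] at h
  exact h

end MarkovChain

/-! ### Valid histories, beliefs and answers to action queries -/

namespace POMDP

variable {S A Z : Type*}

/-- The history of the prefix of length `i` of the path `s₀ a₀ s₁ a₁ …`. The two sequences need not
form a path, so that sequences of states of a product chain can be used as well. -/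
def histAt (P : POMDP S A Z) (s : ℕ → S) (a : ℕ → A) (i : ℕ) : History Z A :=
  ((List.range i).map (fun j => (P.obs (s j), a j)), P.obs (s i))

theorem histAt_succ (P : POMDP S A Z) (s : ℕ → S) (a : ℕ → A) (i : ℕ) :
    P.histAt s a (i + 1) = (P.histAt s a i).snoc (a i) (P.obs (s (i + 1))) := by
  simp [histAt, History.snoc, List.range_succ]

/-- Prefixes of valid histories are valid. -/
theorem Valid.histAt_of_le {P : POMDP S A Z} {s : ℕ → S} {a : ℕ → A} {i j : ℕ}
    (h : P.Valid (P.histAt s a i)) (hj : j ≤ i) : P.Valid (P.histAt s a j) := by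
  obtain ⟨s', a', hp, k, hk⟩ := h
  rw [histAt, Prod.mk.injEq] at hk
  obtain rfl : i = k := by simpa using congrArg List.length hk.1
  have hl : ∀ t < i, P.obs (s t) = P.obs (s' t) ∧ a t = a' t := by
    simpa [List.map_inj_left] using hk.1
  refine ⟨s', a', hp, j, ?_⟩
  rw [histAt, Prod.mk.injEq]
  constructor
  · refine List.map_congr_left fun t ht => ?_
    have := hl t (by have := List.mem_range.1 ht; omega)
    rw [this.1, this.2]
  · rcases hj.lt_or_eq with h | rfl
    · exact (hl j h).1
    · exact hk.2

/-- An infinite path starts in `s₀`. Validity of histories refers to infinite paths, so states from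
which all paths are stuck have to be discarded. -/
def Live (P : POMDP S A Z) (s₀ : S) : Prop :=
  ∃ (s : ℕ → S) (a : ℕ → A), s 0 = s₀ ∧
    ∀ t, ∃ μ, P.trans (s t) (a t) = some μ ∧ s (t + 1) ∈ μ.support

/-- The states that are possible after the observations and actions in `l`, before the next
observation is read. -/
def belief (P : POMDP S A Z) (l : List (Z × A)) : Set S :=
  l.foldl (fun B p => {s' | ∃ s ∈ B, P.obs s = p.1 ∧
    ∃ μ, P.trans s p.2 = some μ ∧ s' ∈ μ.support}) {P.init}

theorem mem_belief_append {P : POMDP S A Z} {l : List (Z × A)} {p : Z × A} {s' : S} :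
    s' ∈ P.belief (l ++ [p]) ↔
      ∃ s ∈ P.belief l, P.obs s = p.1 ∧ ∃ μ, P.trans s p.2 = some μ ∧ s' ∈ μ.support := by
  simp [belief, List.foldl_append]

theorem IsPath.mem_belief {P : POMDP S A Z} {s : ℕ → S} {a : ℕ → A} (h : P.IsPath s a) (i : ℕ) :
    s i ∈ P.belief (P.histAt s a i).1 := by
  induction i with
  | zero => simp [histAt, belief, h.1]
  | succ i ih =>
    rw [histAt_succ, History.snoc, mem_belief_append]
    exact ⟨s i, ih, rfl, h.2 i⟩

/-- An infinite path from a state of the belief can be prolonged backwards to one from the initial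
state that produces the given observations and actions. -/
theorem exists_isPath_of_mem_belief {P : POMDP S A Z} (l : List (Z × A)) :
    ∀ (s : ℕ → S) (a : ℕ → A), s 0 ∈ P.belief l →
      (∀ t, ∃ μ, P.trans (s t) (a t) = some μ ∧ s (t + 1) ∈ μ.support) →
      ∃ s' a', P.IsPath s' a' ∧ ∃ i, (P.histAt s' a' i).1 = l ∧
        ∀ t, s' (i + t) = s t ∧ a' (i + t) = a t := by
  induction l using List.reverseRecOn with
  | nil =>
    intro s a h0 h
    exact ⟨s, a, ⟨by simpa [belief] using h0, h⟩, 0, by simp [histAt]⟩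
  | append_singleton l p ih =>
    intro s a h0 h
    obtain ⟨s₀, hs₀, ho, hμ⟩ := mem_belief_append.1 h0
    obtain ⟨s', a', hp, i, hi, ht⟩ := ih (fun t => Nat.casesOn t s₀ s)
      (fun t => Nat.casesOn t p.2 a) hs₀ (fun t => by cases t with
        | zero => exact hμ
        | succ t => exact h t)
    refine ⟨s', a', hp, i + 1, ?_, fun t => ?_⟩
    · have h0 := ht 0
      simp only [add_zero] at h0
      rw [histAt_succ, History.snoc, hi, h0.2]
      simp [histAt, h0.1, ho]
    · rw [add_assoc, add_comm 1]
      exact ht (t + 1)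

/-- Validity depends on `l` only through the belief, which takes finitely many values. -/
theorem valid_iff {P : POMDP S A Z} {l : List (Z × A)} {z : Z} :
    P.Valid (l, z) ↔ ∃ s ∈ P.belief l, P.obs s = z ∧ P.Live s := by
  constructor
  · rintro ⟨s, a, hp, i, hi⟩
    obtain ⟨rfl, rfl⟩ := Prod.mk.inj hi
    exact ⟨s i, hp.mem_belief i, rfl, fun t => s (i + t), fun t => a (i + t), rfl,
      fun t => hp.2 (i + t)⟩
  · rintro ⟨_, hs, rfl, s, a, rfl, h⟩
    obtain ⟨s', a', hp, i, hi, ht⟩ := exists_isPath_of_mem_belief l s a hs h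
    refine ⟨s', a', hp, i, Prod.ext hi.symm ?_⟩
    exact congrArg P.obs (ht 0).1.symm

theorem Reach.mem_belief {P : POMDP S A Z} {σ : History Z A → A} {s : S} {h : History Z A}
    (hr : P.Reach σ s h) : s ∈ P.belief h.1 ∧ P.obs s = h.2 := by
  induction hr with
  | init => simp [belief]
  | step hr hμ hs ih => exact ⟨mem_belief_append.2 ⟨_, ih.1, ih.2, _, hμ, hs⟩, rfl⟩

/-- Following a policy never leads into a dead end. -/
theorem Reach.live {P : POMDP S A Z} {σ : History Z A → A} (hσ : P.IsPolicy σ) {s : S}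
    {h : History Z A} (hr : P.Reach σ s h) : P.Live s := by
  have key : ∀ x : {x : S × History Z A // P.Reach σ x.1 x.2},
      ∃ y : {x : S × History Z A // P.Reach σ x.1 x.2},
        ∃ μ, P.trans x.1.1 (σ x.1.2) = some μ ∧ y.1.1 ∈ μ.support := by
    rintro ⟨⟨s, h⟩, hr⟩
    obtain ⟨μ, hμ⟩ := hσ s h hr
    obtain ⟨s', hs'⟩ := μ.support_nonempty
    exact ⟨⟨(s', _), hr.step hμ hs'⟩, μ, hμ, hs'⟩
  choose nxt hnxt using key
  refine ⟨fun t => (nxt^[t] ⟨(s, h), hr⟩).1.1, fun t => σ (nxt^[t] ⟨(s, h), hr⟩).1.2, rfl,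
    fun t => ?_⟩
  simp only [Function.iterate_succ_apply']
  exact hnxt _

theorem Reach.valid {P : POMDP S A Z} {σ : History Z A → A} (hσ : P.IsPolicy σ) {s : S}
    {h : History Z A} (hr : P.Reach σ s h) : P.Valid h :=
  valid_iff.2 ⟨s, hr.mem_belief.1, hr.mem_belief.2, hr.live hσ⟩

section Answers

variable (P : POMDP S A Z) (oracle : History Z A → A)

open Classical in
/-- The answer to a single action query, in the encoding of `POMDP.answers`: `st` is the history so
far, or `none` if it is not valid any more. -/
noncomputable def answer : Option (List (Z × A)) → Z → Option A
  | none, _ => none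
  | some l, z => if P.Valid (l, z) then some (oracle (l, z)) else none

/-- The history so far after one more observation has been answered; `none` once it is not valid. -/
noncomputable def advance (st : Option (List (Z × A))) (z : Z) : Option (List (Z × A)) :=
  st.bind fun l => (P.answer oracle st z).map fun a => l ++ [(z, a)]

theorem answers_nil (st : Option (List (Z × A))) : P.answers oracle st [] = [] := by
  cases st <;> rfl

theorem answers_cons (st : Option (List (Z × A))) (z : Z) (w : List Z) :
    P.answers oracle st (z :: w) =
      P.answer oracle st z :: P.answers oracle (P.advance oracle st z) w := by
  cases st with
  | none => rfl
  | some l => by_cases h : P.Valid (l, z) <;> simp [answers, advance, answer, h]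

theorem length_answers (w : List Z) : ∀ st, (P.answers oracle st w).length = w.length := by
  induction w with
  | nil => simp [answers_nil]
  | cons z w ih => simp [answers_cons, ih]

theorem answers_append (s e : List Z) : ∀ st, P.answers oracle st (s ++ e) =
    P.answers oracle st s ++ P.answers oracle (s.foldl (P.advance oracle) st) e := by
  induction s with
  | nil => simp [answers_nil]
  | cons z s ih => simp [answers_cons, ih]

theorem entry_eq (s e : List Z) :
    P.entry oracle s e = P.answers oracle (s.foldl (P.advance oracle) (some [])) e := by
  rw [entry, answers_append, List.drop_left' (P.length_answers oracle s _)]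

theorem entry_cons (s : List Z) (z : Z) (e : List Z) :
    P.entry oracle s (z :: e) = P.answer oracle (s.foldl (P.advance oracle) (some [])) z ::
      P.entry oracle (s ++ [z]) e := by
  rw [entry_eq, entry_eq, answers_cons, List.foldl_append]
  rfl

theorem length_entry (s e : List Z) : (P.entry oracle s e).length = e.length := by
  rw [entry_eq, length_answers]

variable {P oracle}

/-- As long as the oracle plays the actions `a` and the history is valid, reading the observations
reproduces the history. -/
theorem foldl_advance_eq {s : ℕ → S} {a : ℕ → A} (i : ℕ)
    (h : ∀ j < i, P.Valid (P.histAt s a j) ∧ oracle (P.histAt s a j) = a j) :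
    ((List.range i).map fun j => P.obs (s j)).foldl (P.advance oracle) (some []) =
      some (P.histAt s a i).1 := by
  induction i with
  | zero => simp [histAt]
  | succ i ih =>
    obtain ⟨hv, ho⟩ := h i (by omega)
    rw [List.range_succ, List.map_append, List.foldl_append, ih fun j hj => h j (by omega),
      histAt_succ]
    simp only [histAt] at hv ho
    simp [advance, answer, hv, ho, History.snoc, histAt]

theorem getLast?_entry_nil {s : ℕ → S} {a : ℕ → A} {i : ℕ}
    (h : ∀ j < i, P.Valid (P.histAt s a j) ∧ oracle (P.histAt s a j) = a j)
    (hi : P.Valid (P.histAt s a i)) :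
    (P.entry oracle [] ((List.range (i + 1)).map fun j => P.obs (s j))).getLast? =
      some (some (oracle (P.histAt s a i))) := by
  rw [entry_eq, List.foldl_nil, List.range_succ, List.map_append, answers_append,
    foldl_advance_eq i h]
  simp only [histAt] at hi
  simp [answers_cons, answers_nil, answer, histAt, hi]

/-- The node of the controller and the belief determine all future answers. -/
theorem answers_congr {N : Type*} {F : FSC Z A N}
    (hF : ∀ h, P.Valid h → oracle h = F.policy h) (e : List Z) :
    ∀ st st' : Option (List (Z × A)),
      st.map (fun l => (F.run (l.map Prod.fst), P.belief l)) =
        st'.map (fun l => (F.run (l.map Prod.fst), P.belief l)) →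
      P.answers oracle st e = P.answers oracle st' e := by
  induction e with
  | nil => intro st st' _; rw [answers_nil, answers_nil]
  | cons z e ih =>
    intro st st' h
    cases st with
    | none =>
      cases st' with
      | none => rfl
      | some l' => simp at h
    | some l =>
      cases st' with
      | none => simp at h
      | some l' =>
        simp only [Option.map_some, Option.some.injEq, Prod.mk.injEq] at h
        have hv : P.Valid (l, z) ↔ P.Valid (l', z) := by rw [valid_iff, valid_iff, h.2]
        rw [answers_cons, answers_cons]
        by_cases hl : P.Valid (l, z)
        · have hl' := hv.1 hl
          have ha : oracle (l, z) = oracle (l', z) := by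
            rw [hF _ hl, hF _ hl', FSC.policy, FSC.policy, h.1]
          congr 1
          · simp [answer, hl, hl', ha]
          · apply ih
            have hb : P.belief (l ++ [(z, oracle (l', z))]) =
                P.belief (l' ++ [(z, oracle (l', z))]) := by
              ext; rw [mem_belief_append, mem_belief_append, h.2]
            simp only [FSC.run] at h
            simp [advance, answer, hl, hl', ha, FSC.run, List.foldl_append, hb, h.1]
        · have hl' : ¬P.Valid (l', z) := fun h' => hl (hv.2 h')
          simp [answer, advance, hl, hl']

/-- The Myhill-Nerode property of a regular oracle: the rows of the (infinite) full table take only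
finitely many values. -/
theorem IsRegular.exists_finite_classes [Finite S] (h : P.IsRegular oracle) :
    ∃ (n : ℕ) (cls : List Z → Fin n),
      ∀ s s', cls s = cls s' → ∀ e, P.entry oracle s e = P.entry oracle s' e := by
  obtain ⟨N, _, F, hF⟩ := h
  refine ⟨_, fun s => Finite.equivFin (Option (N × Set S))
    ((s.foldl (P.advance oracle) (some [])).map
      fun l => (F.run (l.map Prod.fst), P.belief l)), fun s s' hs e => ?_⟩
  rw [entry_eq, entry_eq]
  exact answers_congr hF e _ _ ((Equiv.injective _) hs)

end Answers

end POMDP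

/-! ### Hypotheses and Rivest-Schapire breakpoints -/

namespace POMDP

variable {S A Z N : Type*} {P : POMDP S A Z} {F : FSC Z A N}

theorem isFinPath_map_range {ω : ℕ → S × N} {n : ℕ} :
    P.IsFinPath F ((List.range n).map ω) ↔
      0 < n ∧ ω 0 = (P.init, F.start) ∧ ∀ j, j + 1 < n → P.Edge F (ω j) (ω (j + 1)) := by
  rw [IsFinPath, List.isChain_iff_getElem, ← and_assoc]
  refine and_congr ?_ ?_
  · cases n <;> simp [List.range_succ_eq_map]
  · simp

theorem disagreeAt_map_range {oracle : History Z A → A} {ω : ℕ → S × N} {n i : ℕ} :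
    P.DisagreeAt oracle F ((List.range n).map ω) i ↔ i < n ∧
      P.Valid (P.histAt (fun j => (ω j).1) (fun j => P.actionAt F (ω j)) i) ∧
      oracle (P.histAt (fun j => (ω j).1) (fun j => P.actionAt F (ω j)) i) ≠
        P.actionAt F (ω i) := by
  by_cases hi : i < n
  · have : P.pathHistory F ((List.range n).map ω) i (ω i) =
        P.histAt (fun j => (ω j).1) (fun j => P.actionAt F (ω j)) i := by
      simp [pathHistory, histAt, ← List.map_take, List.take_range, hi.le, Function.comp_def]
    simp [DisagreeAt, hi, this]
  · simp [DisagreeAt, hi]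

theorem exists_map_range_eq {X : Type*} {ρ : List X} (h : ρ ≠ []) :
    ∃ ω : ℕ → X, ρ = (List.range ρ.length).map ω := by
  refine ⟨fun j => ρ.getD j (ρ.head h), List.ext_getElem (by simp) fun j h1 h2 => ?_⟩
  simp [h1]

theorem snd_eq_run {ω : ℕ → S × N} {n : ℕ} (h0 : ω 0 = (P.init, F.start))
    (h : ∀ j < n, P.Edge F (ω j) (ω (j + 1))) :
    (ω n).2 = F.run ((List.range n).map fun j => P.obs (ω j).1) := by
  induction n with
  | zero => simp [h0, FSC.run]
  | succ n ih =>
    obtain ⟨μ, -, -, h2⟩ := h n (by omega)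
    rw [h2, ih fun j hj => h j (by omega)]
    simp [FSC.run, List.range_succ]

end POMDP

namespace Table

open POMDP

variable {S A Z : Type*} {P : POMDP S A Z} {oracle : History Z A → A} {T : Table Z}

theorem IsHypothesis.next_val_of_row_eq {F : FSC Z A (T.Node P oracle)} (hF : T.IsHypothesis P oracle F)
    {s : List Z} (hs : s ∈ T.rows) {n : T.Node P oracle} (hn : T.row P oracle s = n.1) (z : Z) :
    (F.next n z).1 = T.row P oracle (s ++ [z]) := by
  obtain ⟨n, h⟩ := n
  subst hn
  exact hF.next_eq s hs z

theorem IsHypothesis.act_of_row_eq {F : FSC Z A (T.Node P oracle)} (hF : T.IsHypothesis P oracle F)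
    {s : List Z} (hs : s ∈ T.rows) {n : T.Node P oracle} (hn : T.row P oracle s = n.1) {z : Z}
    {a : A} (h : P.entry oracle s [z] = [some a]) : F.act n z = a := by
  obtain ⟨n, hn'⟩ := n
  subst hn
  exact hF.act_eq s hs z a h

/-- The induction behind the search for a breakpoint. `u` has been read and `v` is still to be read; the
invariant is that the last answer in row `s`, the representative of the node reached on `u`, is
still the answer `a` of the oracle. The invariant fails before the last observation, since there
the hypothesis would have to play `a`; where it fails first, `v` yields a breakpoint. -/
theorem exists_isBreakpoint_of_suffix {F : FSC Z A (T.Node P oracle)} (hT : T.Closed P oracle)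
    (hF : T.IsHypothesis P oracle F) {w : List Z} {z : Z} {a : A}
    (ha : F.act (F.run w) z ≠ a) (v : List Z) :
    ∀ u, w ++ [z] = u ++ v → v ≠ [] → ∀ s ∈ T.rows, T.row P oracle s = (F.run u).1 →
      (P.entry oracle s v).getLast? = some (some a) →
      ∃ e, T.IsBreakpoint P oracle F (w ++ [z]) e := by
  induction v with
  | nil => exact fun _ _ h => (h rfl).elim
  | cons y e ih =>
    intro u hu _ s hs hrow hlast
    rcases eq_or_ne e [] with rfl | he
    · obtain ⟨rfl, rfl⟩ : w = u ∧ z = y := by simpa using List.append_inj' hu rfl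
      refine absurd (hF.act_of_row_eq hs hrow ?_) ha
      obtain ⟨x, hx⟩ := List.length_eq_one_iff.1 (P.length_entry oracle s [z])
      rw [hx] at hlast ⊢
      simpa using hlast
    · obtain ⟨s', hs', hrow'⟩ := hT s hs y
      have hrun : T.row P oracle s' = (F.run (u ++ [y])).1 := by
        rw [hrow', FSC.run, List.foldl_append]
        exact (hF.next_val_of_row_eq hs hrow y).symm
      by_cases hne : P.entry oracle (s ++ [y]) e = P.entry oracle s' e
      · refine ih (u ++ [y]) (by simp [hu]) he s' hs' hrun ?_
        rw [entry_cons, hne] at hlast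
        have : P.entry oracle s' e ≠ [] := by
          rw [← List.length_pos_iff, P.length_entry, List.length_pos_iff]
          exact he
        rwa [List.getLast?_cons_of_ne_nil this] at hlast
      · exact ⟨e, he, u, y, hu, s, hs, s', hs', hrow, hrun, hne⟩

theorem exists_isBreakpoint {F : FSC Z A (T.Node P oracle)} (hT : T.Closed P oracle)
    (hF : T.IsHypothesis P oracle F) (hnil : [] ∈ T.rows) {ρ : List (S × T.Node P oracle)}
    (hρ : P.IsFinPath F ρ) {i : ℕ} (hi : P.FirstDisagreement oracle F ρ i) :
    ∃ e, T.IsBreakpoint P oracle F ((ρ.take (i + 1)).map fun x => P.obs x.1) e := by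
  obtain ⟨ω, hω⟩ := exists_map_range_eq (ρ := ρ) (by rintro rfl; simp [IsFinPath] at hρ)
  generalize ρ.length = n at hω
  subst hω
  obtain ⟨-, h0, hedge⟩ := isFinPath_map_range.1 hρ
  obtain ⟨hd, hfirst⟩ := hi
  obtain ⟨hin, hv, hne⟩ := disagreeAt_map_range.1 hd
  have hagree : ∀ j < i,
      P.Valid (P.histAt (fun j => (ω j).1) (fun j => P.actionAt F (ω j)) j) ∧
      oracle (P.histAt (fun j => (ω j).1) (fun j => P.actionAt F (ω j)) j) =
        P.actionAt F (ω j) := by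
    intro j hj
    have hvj := hv.histAt_of_le hj.le
    refine ⟨hvj, ?_⟩
    by_contra hne'
    exact hfirst j hj (disagreeAt_map_range.2 ⟨hj.trans hin, hvj, hne'⟩)
  have hlast := getLast?_entry_nil hagree hv
  have hw : (((List.range n).map ω).take (i + 1)).map (fun x => P.obs x.1) =
      ((List.range i).map fun j => P.obs (ω j).1) ++ [P.obs (ω i).1] := by
    rw [← List.map_take, List.take_range, min_eq_left (by omega), List.map_map, List.range_succ,
      List.map_append]
    rfl
  rw [hw]
  rw [List.range_succ, List.map_append] at hlast
  refine exists_isBreakpoint_of_suffix hT hF ?_ _ [] rfl (by simp) [] hnil hF.start_eq.symm hlast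
  rw [← snd_eq_run h0 fun j hj => hedge j (by omega)]
  exact hne.symm

theorem Closed.exists_isHypothesis (hT : T.Closed P oracle) (hnil : [] ∈ T.rows)
    (hinj : Set.InjOn (T.row P oracle) T.rows) :
    ∃ F : FSC Z A (T.Node P oracle), T.IsHypothesis P oracle F := by
  classical
  choose rep hrep hrow using fun n : T.Node P oracle => n.2
  have hrep_eq : ∀ s (hs : s ∈ T.rows), rep ⟨_, Set.mem_image_of_mem _ hs⟩ = s := fun s hs =>
    hinj (hrep _) hs (hrow _)
  have hnext : ∀ (n : T.Node P oracle) (z : Z),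
      T.row P oracle (rep n ++ [z]) ∈ T.row P oracle '' (T.rows : Set (List Z)) := fun n z =>
    let ⟨s', hs', h⟩ := hT (rep n) (hrep n) z
    ⟨s', hs', h⟩
  refine ⟨⟨fun n z => ((P.entry oracle (rep n) [z]).head?.join).getD (oracle ([], z)),
    fun n z => ⟨_, hnext n z⟩, ⟨_, Set.mem_image_of_mem _ hnil⟩⟩, rfl, fun s hs z => ?_,
    fun s hs z a h => ?_⟩
  · simp only [hrep_eq s hs]
  · simp [hrep_eq s hs, h]

end Table

/-! ### Counterexamples without disagreement force a low reward -/

theorem le_map_apply {X Y : Type*} (μ : PMF X) (f : X → Y) (x : X) : μ x ≤ μ.map f (f x) := by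
  classical
  rw [PMF.map_apply]
  exact (if_pos rfl).symm.le.trans (ENNReal.le_tsum (f := fun a => if f x = f a then μ a else 0) x)

theorem map_prodMk_apply {X Y : Type*} (μ : PMF X) (y : Y) (x : X) :
    μ.map (fun x' => (x', y)) (x, y) = μ x := by
  classical
  rw [PMF.map_apply]
  refine (tsum_eq_single x fun x' hx' => ?_).trans (if_pos rfl)
  exact if_neg fun h => hx' (Prod.mk.inj h).1.symm

/-- A discounted sum comes close to the undiscounted one as the discount factor tends to `1`. The bound
`c ≤ 1` makes the threshold uniform also when `∑ i, p i` diverges. -/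
theorem exists_discount_le (p : ℕ → ℝ) (hp : ∀ i, 0 ≤ p i) {ε : ℝ} (hε : 0 < ε) :
    ∃ lam₀ ∈ Set.Ioo (0 : ℝ) 1, ∀ lam ∈ Set.Ioo lam₀ 1, ∀ c ≤ (1 : ℝ),
      ENNReal.ofReal c ≤ ∑' i, ENNReal.ofReal (p i) →
        ∀ v, HasSum (fun i => lam ^ i * p i) v → c - ε ≤ v := by
  obtain ⟨n, hn⟩ : ∃ n : ℕ, ∀ c ≤ (1 : ℝ), ENNReal.ofReal c ≤ ∑' i, ENNReal.ofReal (p i) →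
      c - ε / 2 ≤ ∑ i ∈ Finset.range n, p i := by
    by_cases hs : Summable p
    · obtain ⟨n, hn⟩ := (hs.hasSum.tendsto_sum_nat.eventually
        (lt_mem_nhds (sub_lt_self _ (half_pos hε)))).exists
      refine ⟨n, fun c _ hc => ?_⟩
      rw [← ENNReal.ofReal_tsum_of_nonneg hp hs,
        ENNReal.ofReal_le_ofReal_iff (tsum_nonneg hp)] at hc
      linarith
    -- If the sum diverges, some partial sum exceeds every admissible `c`.
    · obtain ⟨n, hn⟩ := (((not_summable_iff_tendsto_nat_atTop_of_nonneg hp).1 hs).eventually_ge_atTop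
        1).exists
      exact ⟨n, fun c hc _ => by linarith⟩
  have hcont : Continuous fun lam : ℝ => ∑ i ∈ Finset.range n, lam ^ i * p i := by fun_prop
  have hev : ∀ᶠ lam in 𝓝[<] (1 : ℝ),
      (∑ i ∈ Finset.range n, p i) - ε / 2 < ∑ i ∈ Finset.range n, lam ^ i * p i := by
    refine (hcont.tendsto 1).mono_left nhdsWithin_le_nhds |>.eventually (lt_mem_nhds ?_)
    simpa using half_pos hε
  obtain ⟨l, hl, hsub⟩ := (mem_nhdsLT_iff_exists_mem_Ico_Ioo_subset zero_lt_one).1 hev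
  refine ⟨max l (1 / 2), ⟨by positivity, max_lt hl.2 (by norm_num)⟩, fun lam hlam c hc hcp v hv => ?_⟩
  have hlam0 : 0 ≤ lam := hl.1.trans ((le_max_left _ _).trans hlam.1.le)
  have h1 := hsub ⟨(le_max_left l _).trans_lt hlam.1, hlam.2⟩
  have h2 := sum_le_hasSum (Finset.range n)
    (fun i _ => mul_nonneg (pow_nonneg hlam0 i) (hp i)) hv
  have h3 := hn c hc hcp
  have h1' : (∑ i ∈ Finset.range n, p i) - ε / 2 < ∑ i ∈ Finset.range n, lam ^ i * p i := h1
  linarith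

namespace POMDP

variable {S A Z N : Type*} {P : POMDP S A Z}

section Product

variable {F : FSC Z A N} {x y : S × N}

theorem edge_of_step_ne_zero (hen : P.trans x.1 (P.actionAt F x) ≠ none)
    (h : (P.prod F).step x y ≠ 0) : P.Edge F x y := by
  obtain ⟨μ, hμ⟩ := Option.ne_none_iff_exists'.1 hen
  rw [← PMF.mem_support_iff] at h
  simp only [prod, hμ, PMF.mem_support_map_iff] at h
  obtain ⟨s', hs', rfl⟩ := h
  exact ⟨μ, hμ, hs', rfl⟩

theorem prod_step_of_edge {μ : PMF S} (hμ : P.trans x.1 (P.actionAt F x) = some μ)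
    (h : y.2 = F.next x.2 (P.obs x.1)) : (P.prod F).step x y = μ y.1 := by
  obtain ⟨s', n'⟩ := y
  obtain rfl : n' = _ := h
  simp only [prod, hμ]
  exact map_prodMk_apply μ _ s'

/-- The set of all finite unsafe paths is a counterexample of probability at least
`1 - Pr(□ ¬Bad)`: almost every run starts in the initial state and uses only transitions of
positive probability, so its prefix up to the first unsafe state is a path. -/
theorem le_pr_cyl_unsafePaths [Finite S] [Finite N] (P : POMDP S A Z) (Bad : Set Z) (F : FSC Z A N) :
    1 - P.prSafe Bad F ≤
      (P.prod F).Pr (Cyl {ρ | P.IsFinPath F ρ ∧ ∃ x ∈ ρ, P.UnsafeState Bad F x}) := by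
  let : MeasurableSpace (S × N) := ⊤
  set M := P.prod F with hM
  set C := Cyl {ρ | P.IsFinPath F ρ ∧ ∃ x ∈ ρ, P.UnsafeState Bad F x} with hC
  have hcov : Set.univ ⊆ (P.alwaysSafe Bad F ∪ C) ∪
      ({ω | ω 0 ≠ M.init} ∪ ⋃ n, {ω | M.step (ω n) (ω (n + 1)) = 0}) := by
    classical
    intro ω _
    by_contra hω
    simp only [Set.mem_union, not_or, Set.mem_iUnion, Set.mem_ofPred_eq, not_exists, not_not] at hω
    obtain ⟨⟨hsafe, hω⟩, h0, hstep⟩ := hω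
    have hex : ∃ i, P.UnsafeState Bad F (ω i) := by
      simpa [alwaysSafe] using hsafe
    refine hω ⟨(List.range (Nat.find hex + 1)).map ω, ⟨isFinPath_map_range.2 ⟨by omega, h0,
      fun j hj => edge_of_step_ne_zero (fun hnone => ?_) (hstep j)⟩, ?_⟩, by simp⟩
    -- A state in which the run is blocked is unsafe, so the run is not blocked before.
    · exact Nat.find_min hex (by omega : j < Nat.find hex) (Or.inr hnone)
    · exact ⟨_, List.mem_map_of_mem (by simp), Nat.find_spec hex⟩
  have hnull : M.runMeasure
      ({ω | ω 0 ≠ M.init} ∪ ⋃ n, {ω | M.step (ω n) (ω (n + 1)) = 0}) = 0 :=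
    measure_union_null M.runMeasure_init_ne (measure_iUnion_null M.runMeasure_step_eq_zero)
  have hle : 1 ≤ M.runMeasure (P.alwaysSafe Bad F) + M.runMeasure C := by
    rw [← M.runMeasure_univ]
    refine (measure_mono hcov).trans ((measure_union_le _ _).trans ?_)
    rw [hnull, add_zero]
    exact measure_union_le _ _
  have hfin : ∀ E, M.runMeasure E ≠ ∞ := fun E => ne_top_of_le_ne_top ENNReal.one_ne_top
    (M.runMeasure_univ ▸ measure_mono (Set.subset_univ E))
  have := ENNReal.toReal_mono (ENNReal.add_ne_top.2 ⟨hfin _, hfin _⟩) hle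
  rw [ENNReal.toReal_add (hfin _) (hfin _), ENNReal.toReal_one] at this
  rw [prSafe, MarkovChain.Pr, MarkovChain.Pr]
  linarith

theorem exists_isAnswer [Finite S] [Finite N] {Bad : Set Z} {α : ℝ} (h : P.prSafe Bad F ≤ α) :
    ∃ R, P.IsAnswer Bad α F R := by
  by_cases hfin : ∃ R, P.IsCounterexample Bad α F R ∧ R.Finite
  · obtain ⟨R, hR, hfin⟩ := hfin
    exact ⟨R, hR, Or.inl hfin⟩
  · push Not at hfin
    exact ⟨_, ⟨fun ρ hρ => hρ, (by linarith : 1 - α ≤ 1 - P.prSafe Bad F).trans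
      (P.le_pr_cyl_unsafePaths Bad F)⟩, Or.inr hfin⟩

end Product

/-- A history of `P` read as a history of `Pʳ` in which the fresh observation does not occur. -/
def liftHistory (h : History Z A) : History (Option Z) A :=
  (h.1.map fun p => (some p.1, p.2), some h.2)

theorem liftHistory_snoc (h : History Z A) (a : A) (z : Z) :
    liftHistory (h.snoc a z) = (liftHistory h).snoc a (some z) := by
  simp [liftHistory, History.snoc]

theorem liftPolicy_liftHistory (σ : History Z A → A) (h : History Z A) :
    P.liftPolicy σ (liftHistory h) = σ h := by
  simp [liftPolicy, liftHistory, List.filterMap_map]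

/-- Before a bad observation, `Pʳ` under `σ` moves as `P` does. -/
theorem le_inducedChain_step {Bad : Set Z} {σ : History Z A → A} {s s' : S} {h : History Z A}
    {μ : PMF S} (hs : P.obs s ∉ Bad) (hμ : P.trans s (σ h) = some μ) :
    μ s' ≤ ((P.rewardPOMDP Bad).inducedChain (P.liftPolicy σ)).step (some s, liftHistory h)
      (some s', liftHistory (h.snoc (σ h) (P.obs s'))) := by
  have htrans : (P.rewardPOMDP Bad).trans (some s) (σ h) = some (μ.map some) := by
    simp [rewardPOMDP, hs, hμ]
  simp only [inducedChain, liftPolicy_liftHistory, htrans]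
  rw [liftHistory_snoc]
  exact (le_map_apply μ some s').trans (le_map_apply (μ.map some)
    (fun s' => (s', (liftHistory h).snoc (σ h) ((P.rewardPOMDP Bad).obs s'))) (some s'))

/-- A path on which oracle and controller never disagree is a run of the policy. Disagreement is only
registered after valid histories, but histories of runs of a policy are valid. -/
theorem reach_histAt {F : FSC Z A N} {σ : History Z A → A} (hσ : P.IsPolicy σ)
    {ω : ℕ → S × N} {n : ℕ} (hρ : P.IsFinPath F ((List.range n).map ω))
    (hno : ∀ i, ¬P.DisagreeAt σ F ((List.range n).map ω) i) {j : ℕ} (hj : j < n) :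
    P.Reach σ (ω j).1 (P.histAt (fun j => (ω j).1) (fun j => P.actionAt F (ω j)) j) ∧
      σ (P.histAt (fun j => (ω j).1) (fun j => P.actionAt F (ω j)) j) = P.actionAt F (ω j) := by
  obtain ⟨-, h0, hedge⟩ := isFinPath_map_range.1 hρ
  have hagree : ∀ j < n,
      P.Reach σ (ω j).1 (P.histAt (fun j => (ω j).1) (fun j => P.actionAt F (ω j)) j) →
      σ (P.histAt (fun j => (ω j).1) (fun j => P.actionAt F (ω j)) j) = P.actionAt F (ω j) := by
    intro j hj hr
    by_contra hne
    exact hno j (disagreeAt_map_range.2 ⟨hj, hr.valid hσ, hne⟩)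
  induction j with
  | zero =>
    have : P.Reach σ (ω 0).1 (P.histAt (fun j => (ω j).1) (fun j => P.actionAt F (ω j)) 0) := by
      simp only [histAt, h0]
      exact Reach.init
    exact ⟨this, hagree 0 hj this⟩
  | succ j ih =>
    obtain ⟨hr, ha⟩ := ih (by omega)
    obtain ⟨μ, hμ, hs, -⟩ := hedge j hj
    have : P.Reach σ (ω (j + 1)).1
        (P.histAt (fun j => (ω j).1) (fun j => P.actionAt F (ω j)) (j + 1)) := by
      rw [histAt_succ, ← ha]
      exact hr.step (ha ▸ hμ) hs
    exact ⟨this, hagree _ hj this⟩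

/-- The states of the chain induced on `Pʳ` that carry the reward `-1`. -/
def badStates (P : POMDP S A Z) (Bad : Set Z) : Set (Option S × History (Option Z) A) :=
  {x | ∃ z ∈ Bad, (P.rewardPOMDP Bad).obs x.1 = some z}

/-- The total probability of unsafe paths without disagreement is at most the expected number of visits
of `Pʳ` to bad states under `σ`. -/
theorem runMeasure_cyl_le [Finite S] [Finite A] [Finite Z] [Finite N] {Bad : Set Z}
    {F : FSC Z A N} {σ : History Z A → A} (hσ : P.IsPolicy σ) {R : Set (List (S × N))}
    (hR : ∀ ρ ∈ R, P.IsFinPath F ρ ∧ ∃ x ∈ ρ, P.UnsafeState Bad F x)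
    (hno : ∀ ρ ∈ R, ∀ i, ¬P.DisagreeAt σ F ρ i) :
    (P.prod F).runMeasure (Cyl R) ≤
      ∑' i, ((P.rewardPOMDP Bad).inducedChain (P.liftPolicy σ)).runMeasure
        {ω | ω i ∈ P.badStates Bad} := by
  classical
  let : MeasurableSpace (S × N) := ⊤
  let : MeasurableSpace (Option S × History (Option Z) A) := ⊤
  let K : (ℕ → S × N) → ℕ → History Z A := fun ω =>
    P.histAt (fun j => (ω j).1) (fun j => P.actionAt F (ω j))
  -- `E i`: the first bad observation is at time `i`, and `σ` and `F` agree before.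
  let E : ℕ → Set (ℕ → S × N) := fun i => {ω | ω 0 = (P.init, F.start) ∧
    (∀ j < i, P.Edge F (ω j) (ω (j + 1)) ∧ P.obs (ω j).1 ∉ Bad ∧
      σ (K ω j) = P.actionAt F (ω j)) ∧ P.obs (ω i).1 ∈ Bad}
  have hcov : Cyl R ⊆ ⋃ i, E i := by
    rintro ω ⟨ρ, hρ, hω⟩
    obtain ⟨hpath, x, hx, hbad⟩ := hR ρ hρ
    have hn := hno ρ hρ
    generalize ρ.length = n at hω
    subst hω
    obtain ⟨k, hk, rfl⟩ : ∃ k < n, ω k = x := by simpa using hx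
    -- The path is not blocked, since its prefixes are runs of the policy `σ`.
    have hkbad : P.obs (ω k).1 ∈ Bad := by
      refine hbad.resolve_right fun hnone => ?_
      obtain ⟨hr, ha⟩ := reach_histAt hσ hpath hn hk
      obtain ⟨μ, hμ⟩ := hσ _ _ hr
      rw [ha, hnone] at hμ
      cases hμ
    have hex : ∃ k, P.obs (ω k).1 ∈ Bad := ⟨k, hkbad⟩
    have hlt : Nat.find hex < n := (Nat.find_min' hex hkbad).trans_lt hk
    obtain ⟨-, h0, hedge⟩ := isFinPath_map_range.1 hpath
    exact Set.mem_iUnion.2 ⟨Nat.find hex, h0, fun j hj => ⟨hedge j (by omega),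
      Nat.find_min hex hj, (reach_histAt hσ hpath hn (by omega)).2⟩, Nat.find_spec hex⟩
  refine (measure_mono hcov).trans ((measure_iUnion_le _).trans
    (ENNReal.tsum_le_tsum fun i => ?_))
  refine MarkovChain.runMeasure_le_of_map _ _ i
    (fun ω j => (some (ω j).1, liftHistory (K ω j))) ?_ ?_ ?_ ?_
  · rintro ω ⟨h0, -, -⟩
    simp [K, histAt, liftHistory, inducedChain, rewardPOMDP, h0]
  · rintro ω ⟨-, h, -⟩ j hj
    obtain ⟨⟨μ, hμ, -, hnode⟩, hsafe, ha⟩ := h j hj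
    rw [prod_step_of_edge hμ hnode]
    have := le_inducedChain_step (s' := (ω (j + 1)).1) hsafe (ha ▸ hμ)
    rw [ha] at this
    simpa only [K, histAt_succ] using this
  · rintro ω ⟨h0, h, -⟩ ω' ⟨h0', h', -⟩ heq j hj
    have hfst : ∀ j ≤ i, (ω j).1 = (ω' j).1 := fun j hj =>
      Option.some.inj (Prod.mk.inj (heq j hj)).1
    refine Prod.ext (hfst j hj) ?_
    -- The nodes of the controller are determined by the observations.
    rw [snd_eq_run h0 fun t ht => (h t (by omega)).1,
      snd_eq_run h0' fun t ht => (h' t (by omega)).1]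
    congr 1
    exact List.map_congr_left fun t ht => by
      rw [hfst t (by have := List.mem_range.1 ht; omega)]
  · rintro ω ⟨-, -, hbad⟩ ω' hω'
    exact ⟨_, hbad, by simp [hω' i le_rfl, rewardPOMDP]⟩

/-- For discount factors close to `1`, a policy with a high reward disagrees with each controller on some
path of each counterexample. The threshold depends only on the policy and `ε`. -/
theorem exists_discount_safetyReward [Finite S] [Finite A] [Finite Z] (Bad : Set Z)
    {σ : History Z A → A} (hσ : P.IsPolicy σ) {ε : ℝ} (hε : 0 < ε) :
    ∃ lam₀ ∈ Set.Ioo (0 : ℝ) 1, ∀ lam ∈ Set.Ioo lam₀ 1, ∀ α, 0 ≤ α →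
      α + ε < 1 + P.safetyReward Bad σ lam →
      ∀ (N : Type _) [Finite N] (F : FSC Z A N) (R : Set (List (S × N))),
        P.IsCounterexample Bad α F R → ∃ ρ ∈ R, ∃ i, P.DisagreeAt σ F ρ i := by
  classical
  set M := (P.rewardPOMDP Bad).inducedChain (P.liftPolicy σ) with hM
  obtain ⟨lam₀, hlam₀, hlam⟩ := exists_discount_le
    (fun i => M.Pr {ω | ω i ∈ P.badStates Bad}) (fun i => ENNReal.toReal_nonneg) hε
  refine ⟨lam₀, hlam₀, fun lam hl α hα hrew N _ F R hR => ?_⟩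
  by_contra! hno
  have hsum := M.hasSum_expect_discounted (P.badStates Bad) (hlam₀.1.trans hl.1).le hl.2
  -- The reward at a bad state does not depend on the action.
  have hexp : (M.expect fun i x => lam ^ i * if x ∈ P.badStates Bad then -1 else 0) =
      P.safetyReward Bad σ lam := by
    rw [safetyReward, expReward]
    congr 1
    funext i x
    congr 1
    by_cases hx : x ∈ P.badStates Bad
    · have hx' : ∃ z ∈ Bad, (P.rewardPOMDP Bad).obs x.1 = some z := hx
      rw [if_pos hx, badReward, if_pos hx']
      norm_num
    · have hx' : ¬∃ z ∈ Bad, (P.rewardPOMDP Bad).obs x.1 = some z := hx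
      rw [if_neg hx, badReward, if_neg hx']
      norm_num
  rw [hexp] at hsum
  let : MeasurableSpace (Option S × History (Option Z) A) := ⊤
  have hfin : ∀ E, M.runMeasure E ≠ ∞ := fun E => ne_top_of_le_ne_top ENNReal.one_ne_top
    (M.runMeasure_univ ▸ measure_mono (Set.subset_univ E))
  have := hlam lam hl (1 - α) (by linarith) ?_ _ hsum
  · linarith
  · refine (ENNReal.ofReal_le_ofReal hR.2).trans (ENNReal.ofReal_toReal_le.trans ?_)
    refine (runMeasure_cyl_le hσ hR.1 hno).trans (le_of_eq (tsum_congr fun i => ?_))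
    exact (ENNReal.ofReal_toReal (hfin _)).symm

end POMDP

/-! ### Termination of the procedure -/

namespace Table

variable {S A Z : Type*} {P : POMDP S A Z} {oracle : History Z A → A} {T : Table Z}

theorem row_eq_iff {s s' : List Z} : T.row P oracle s = T.row P oracle s' ↔
    ∀ e ∈ T.cols, P.entry oracle s e = P.entry oracle s' e := by
  simp [row, funext_iff]

/-- The invariant of the tables that occur: the empty sequence is a row, and different rows have
different values. The latter makes the choice of actions in a hypothesis consistent. -/
structure IsReduced (P : POMDP S A Z) (oracle : History Z A → A) (T : Table Z) : Prop where
  nil_mem : [] ∈ T.rows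
  injOn : Set.InjOn (T.row P oracle) T.rows

theorem isReduced_initial [Fintype Z] [DecidableEq Z] : (initial Z).IsReduced P oracle :=
  ⟨by simp [initial], by simp [initial]⟩

/-- Pairs of classes that are told apart by the columns of the table, where `cls` assigns to each
sequence the class of its row in the full table. -/
def separated (P : POMDP S A Z) (oracle : History Z A → A) {n : ℕ} (cls : List Z → Fin n)
    (T : Table Z) : Set (Fin n × Fin n) :=
  {q | ∃ s s', cls s = q.1 ∧ cls s' = q.2 ∧ T.row P oracle s ≠ T.row P oracle s'}

/-- The quantity that grows in each step between tables. -/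
noncomputable def potential (P : POMDP S A Z) (oracle : History Z A → A) {n : ℕ}
    (cls : List Z → Fin n) (T : Table Z) : ℕ :=
  (T.separated P oracle cls).ncard + T.rows.card

theorem IsReduced.potential_le (hT : T.IsReduced P oracle) {n : ℕ} {cls : List Z → Fin n}
    (hcls : ∀ s s', cls s = cls s' → ∀ e, P.entry oracle s e = P.entry oracle s' e) :
    T.potential P oracle cls ≤ n * n + n := by
  refine add_le_add ?_ ?_
  · refine (Set.ncard_le_ncard (Set.subset_univ _)).trans ?_
    simp [Set.ncard_univ]
  · have := Finset.card_le_card_of_injOn (s := T.rows) (t := Finset.univ) cls (by simp)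
      fun s hs s' hs' h => hT.injOn hs hs' (row_eq_iff.2 fun e _ => hcls s s' h e)
    simpa using this

end Table

section Procedure

open Table

variable {S A Z : Type*} [Finite S] [DecidableEq Z] {P : POMDP S A Z} {Bad : Set Z} {α : ℝ}
  {oracle : History Z A → A} {T T' : Table Z}

theorem Step.isReduced (h : Step P Bad α oracle (.table T) (.table T'))
    (hT : T.IsReduced P oracle) : T'.IsReduced P oracle := by
  cases h with
  | close _ s z hs hnew =>
    refine ⟨Finset.mem_insert_of_mem hT.nil_mem, ?_⟩
    have hmem : s ++ [z] ∉ (T.rows : Set (List Z)) := fun h => hnew _ h rfl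
    rw [addRow, Finset.coe_insert]
    refine (Set.injOn_insert hmem).2 ⟨hT.injOn, ?_⟩
    rintro ⟨s', hs', h⟩
    exact hnew s' hs' h
  | refine _ F hcl hF hviol R hR ρ hρ i hi e he =>
    refine ⟨hT.nil_mem, fun s hs s' hs' h => hT.injOn hs hs' ?_⟩
    exact row_eq_iff.2 fun e' he' => row_eq_iff.1 h e' (Finset.mem_insert_of_mem he')

/-- A new row increases the number of rows. A Rivest-Schapire column separates the classes of `s z`
and `s'`, whose rows were equal because the hypothesis moves from the row of `s` to that of `s'`. -/
theorem Step.potential_lt (h : Step P Bad α oracle (.table T) (.table T')) {n : ℕ}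
    {cls : List Z → Fin n}
    (hcls : ∀ s s', cls s = cls s' → ∀ e, P.entry oracle s e = P.entry oracle s' e) :
    T.potential P oracle cls < T'.potential P oracle cls := by
  cases h with
  | close _ s z hs hnew =>
    have hmem : s ++ [z] ∉ T.rows := fun h => hnew _ h rfl
    refine Nat.add_lt_add_left ?_ _
    rw [addRow, Finset.card_insert_of_notMem hmem]
    exact Nat.lt_succ_self _
  | refine _ F hcl hF hviol R hR ρ hρ i hi e he =>
    refine Nat.add_lt_add_right (Set.ncard_lt_ncard ?_) _
    obtain ⟨-, u, z, -, s, hs, s', hs', hrow, hrow', hne⟩ := he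
    have heq : T.row P oracle (s ++ [z]) = T.row P oracle s' := by
      rw [hrow', FSC.run, List.foldl_append]
      exact (hF.next_val_of_row_eq hs hrow z).symm
    refine Set.ssubset_iff_exists.2 ⟨?_, (cls (s ++ [z]), cls s'), ?_, ?_⟩
    · rintro q ⟨t, t', ht, ht', h⟩
      refine ⟨t, t', ht, ht', fun heq => h (row_eq_iff.2 fun e' he' => ?_)⟩
      exact row_eq_iff.1 heq e' (Finset.mem_insert_of_mem he')
    · exact ⟨_, _, rfl, rfl, fun h => hne (row_eq_iff.1 h e (Finset.mem_insert_self _ _))⟩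
    · rintro ⟨t, t', ht, ht', h⟩
      refine h (row_eq_iff.2 fun e' he' => ?_)
      rw [hcls _ _ ht, hcls _ _ ht', row_eq_iff.1 heq e' he']

theorem exists_step (hT : T.IsReduced P oracle) : ∃ c, Step P Bad α oracle (.table T) c := by
  classical
  by_cases hcl : T.Closed P oracle
  · obtain ⟨F, hF⟩ := hcl.exists_isHypothesis hT.nil_mem hT.injOn
    rcases lt_or_ge α (P.prSafe Bad F) with hsafe | hviol
    · exact ⟨_, .accept T F hcl hF hsafe⟩
    · obtain ⟨R, hR⟩ := POMDP.exists_isAnswer hviol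
      by_cases hno : ∀ ρ ∈ R, ∀ i, ¬P.DisagreeAt oracle F ρ i
      · exact ⟨_, .fail T F hcl hF hviol R hR hno⟩
      · push Not at hno
        obtain ⟨ρ, hρ, hex⟩ := hno
        have hi : P.FirstDisagreement oracle F ρ (Nat.find hex) :=
          ⟨Nat.find_spec hex, fun j hj => Nat.find_min hex hj⟩
        obtain ⟨e, he⟩ := exists_isBreakpoint hcl hF hT.nil_mem (hR.1.1 ρ hρ).1 hi
        exact ⟨_, .refine T F hcl hF hviol R hR ρ hρ _ hi e he⟩
  · simp only [Closed, not_forall, not_exists, not_and] at hcl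
    obtain ⟨s, hs, z, hnew⟩ := hcl
    exact ⟨_, .close T s z hs hnew⟩

variable [Fintype Z]

theorem Reachable.isReduced (h : Reachable P Bad α oracle (.table T)) : T.IsReduced P oracle := by
  generalize hc : Config.table T = c at h
  induction h generalizing T with
  | refl =>
    cases hc
    exact isReduced_initial
  | tail _ hstep ih =>
    subst hc
    have hstep' := hstep
    cases hstep' with
    | close => exact hstep.isReduced (ih rfl)
    | refine => exact hstep.isReduced (ih rfl)

theorem Returns.lt_prSafe {F : FSC Z A (T.Node P oracle)} (h : Returns P Bad α oracle F) :
    α < P.prSafe Bad F := by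
  obtain h | ⟨c, -, hstep⟩ := Relation.ReflTransGen.cases_tail h
  · cases h
  · cases hstep
    assumption

theorem not_exists_infinite_run (hreg : P.IsRegular oracle) :
    ¬∃ c : ℕ → Config P oracle,
      c 0 = .table (Table.initial Z) ∧ ∀ n, Step P Bad α oracle (c n) (c (n + 1)) := by
  rintro ⟨c, h0, hstep⟩
  obtain ⟨n, cls, hcls⟩ := hreg.exists_finite_classes
  have key : ∀ m, ∃ T, c m = .table T ∧ T.IsReduced P oracle ∧ m ≤ T.potential P oracle cls := by
    intro m
    induction m with
    | zero => exact ⟨_, h0, isReduced_initial, Nat.zero_le _⟩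
    | succ m ih =>
      obtain ⟨T, hT, hred, hle⟩ := ih
      obtain ⟨T', hT'⟩ : ∃ T', c (m + 1) = .table T' := by
        have h := hstep (m + 1)
        generalize c (m + 1) = d, c (m + 1 + 1) = d' at h
        cases h <;> exact ⟨_, rfl⟩
      have h := hstep m
      rw [hT, hT'] at h
      exact ⟨T', hT', h.isReduced hred, hle.trans_lt (h.potential_lt hcls)⟩
  obtain ⟨T, -, hred, hle⟩ := key (n * n + n + 1)
  have := hred.potential_le hcls
  omega

/-- Besides returning a controller, a run could only end by failing, which needs a counterexample
without any disagreement. -/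
theorem alwaysReturns (hreg : P.IsRegular oracle)
    (hdis : ∀ (T : Table Z) (F : FSC Z A (T.Node P oracle)) (R : Set (List (S × T.Node P oracle))),
      P.IsCounterexample Bad α F R → ∃ ρ ∈ R, ∃ i, P.DisagreeAt oracle F ρ i) :
    AlwaysReturns P Bad α oracle := by
  refine ⟨not_exists_infinite_run hreg, fun c hc hend => ?_⟩
  cases c with
  | table T =>
    obtain ⟨c', hc'⟩ := exists_step (Bad := Bad) (α := α) hc.isReduced
    exact (hend c' hc').elim
  | returned T F => exact ⟨T, F, rfl⟩
  | fail =>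
    obtain h | ⟨c, -, hstep⟩ := Relation.ReflTransGen.cases_tail hc
    · cases h
    · cases hstep with
      | fail T F _ _ _ R hR hno =>
        obtain ⟨ρ, hρ, i, hi⟩ := hdis T F R hR.1
        exact (hno ρ hρ i hi).elim

end Procedure

end CPlus

theorem theorem2 {S A Z : Type*} [Finite S] [Finite A] [Fintype Z] [DecidableEq Z]
    (P : POMDP S A Z) (Bad : Set Z) (α : ℝ) (hα₀ : 0 ≤ α) (hα₁ : α < 1) :
    -- correctness
    (∀ (oracle : History Z A → A) (T : Table Z) (F : FSC Z A (T.Node P oracle)),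
      Returns P Bad α oracle F → α < P.prSafe Bad F) ∧
    -- relative completeness
    (∀ ε : ℝ, 0 < ε → ∀ σ : History Z A → A, P.IsPolicy σ → P.IsRegular σ →
      ∃ lam₀ ∈ Set.Ioo (0 : ℝ) 1, ∀ lam ∈ Set.Ioo lam₀ 1,
        α + ε < 1 + P.safetyReward Bad σ lam → AlwaysReturns P Bad α σ) := by
  refine ⟨fun oracle T F h => h.lt_prSafe, fun ε hε σ hσ hreg => ?_⟩
  obtain ⟨lam₀, hlam₀, h⟩ := P.exists_discount_safetyReward Bad hσ hε
  exact ⟨lam₀, hlam₀, fun lam hlam hrew => alwaysReturns hreg fun T F R hR =>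
    h lam hlam α hα₀ hrew _ F R hR⟩
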